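/- **Setting.** Let $\mathbb H$ be the quaternions with their Euclidean structure, made a complex vector space by right multiplication by $i$; let $I,J,K$ be left multiplication by $i,j,k$. Let $V$ be an affine space with underlying vector space $\mathbb H$ (identified with $\mathbb H$ by choosing an origin), $\Gamma\subset\mathbb H$ a lattice, $M=V/\Gamma$ the flat quotient $4$-torus with projection $p:V\to M$, and $\mathscr T$ a Euclidean triangulation of $M$, i.e. a finite simplicial decomposition each of whose cells is the bijective image under $p$ of a Euclidean simplex of $V$. Let $\mathscr F$ be the space of locally constant $\mathbb H$-valued $1$-forms on the complement of the $3$-skeleton, that is, families $F=(F(\sigma))_\sigma$ of $\mathbb R$-linear maps $\mathbb H\to\mathbb H$ indexed by the $4$-cells $\sigma$ of $\mathscr T$, with the Euclidean metric $$\mathcal G(F_1,F_2)=\sum_{\sigma} g\big(F_1(\sigma),F_2(\sigma)\big)\,\mathrm{vol}(\sigma),\qquad g(A,B)=\sum_{e\in\{1,i,j,k\}}\langle Ae,Be\rangle .$$ Let $\mathscr F^c\subset\mathscr F$ be the subspace of Whitney forms: for any two intersecting $4$-cells $\sigma,\tau$, the maps $F(\sigma)$ and $F(\tau)$ agree on vectors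 tangent to $\sigma\cap\tau$. A polyhedral function $M\to\mathbb H$ is a continuous function that is affine on each cell. Let $H^1(M,\mathbb H)$ be the quotient of $\mathscr F^c$ by the differentials of polyhedral functions $M\to\mathbb H$, and for $\alpha\in H^1(M,\mathbb H)$ let $$\mathscr F^c_\alpha=\{F\in\mathscr F^c:\ [F]\in\mathbb R\alpha\}.$$ The hyperkähler moment map $\boldsymbol\mu=(\mu_I,\mu_J,\mu_K)$ sends $F$ to the triple of locally constant functions $$\mu_\bullet(F)=-\tfrac12\, g(\mathscr R_\bullet F,F),\qquad \mathscr R_\bullet F(v)=-F(\bullet\, v)\,i,\qquad \bullet=I,J,K.$$ Let $\phi(F)=\tfrac12\|\boldsymbol\mu(F)\|^2=\tfrac12\sum_\bullet\sum_\sigma \mu_\bullet(F)(\sigma)^2\,\mathrm{vol}(\sigma)$. The modified moment map flow on $\mathscr F^c_\alpha$ is $$\frac{\partial F_t}{\partial t}=-\Pi_\alpha\nabla\phi(F_t),$$ where $\nabla$ is the gradient for $\mathcal G$ and $\Pi_\alpha:\mathscr F\to\mathscr F^c_\alpha$ is the $\mathcal G$-orthogonal projection. Put $Z=\mathscr F^c_\alpha\cap\boldsymbol\mu^{-1}(0)$.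 A point $F\in Z$ is called regular if $\boldsymbol\mu:\mathscr F^c_\alpha\to\mathfrak t^3$, with $\mathfrak t$ the space of locally constant real functions, has constant rank on a neighbourhood of $F$ in $\mathscr F^c_\alpha$. **Theorem.** Let $\alpha\in H^1(M,\mathbb H)$ and let $F\in Z$ be a regular point. Then the modified moment map flow is stable in a neighbourhood of $F$ and converges exponentially fast. Precisely: there are constants $C,\lambda>0$ such that for every neighbourhood $U$ of $F$ in $\mathscr F^c_\alpha$ there is a neighbourhood $W$ of $F$ with the following property. For every $F_0\in W$ there is a solution $(F_t)_{t\ge 0}$ of the flow with initial condition $F_0$, and every such solution stays in $U$ for all $t\geq 0$ and converges to some $F_\infty\in U\cap Z$, with $$\|F_t-F_\infty\|_{\mathcal G}\le C e^{-\lambda t}\,\mathrm{dist}_{\mathcal G}(F_0,Z)\qquad\text{for all } t\ge 0 .$$ -/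

import Mathlib

open scoped Topology InnerProductSpace

noncomputable section

namespace PolyTorus

/-- The quaternions, a four-dimensional Euclidean space with orthonormal basis `1, i, j, k`.
The affine space `V` is identified with its underlying vector space by the choice of an origin. -/
abbrev HH : Type := Quaternion ℝ

instance : MeasurableSpace HH := borel HH

instance : BorelSpace HH := ⟨rfl⟩

/-- The imaginary units `i`, `j`, `k`. -/
def unit : Fin 3 → HH := ![⟨0, 1, 0, 0⟩, ⟨0, 0, 1, 0⟩, ⟨0, 0, 0, 1⟩]

/-- The orthonormal basis `1, i, j, k`. -/
def stdBasis : Fin 4 → HH := ![1, unit 0, unit 1, unit 2]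

/-! ### Linear algebra of `ℝ`-linear maps `HH → HH` (the fibre of `T^*M ⊗ HH`) -/

/-- The Euclidean inner product `g` on `HH^* ⊗ HH` induced by the inner product of `HH`. -/
def fibreInner (A B : HH →ₗ[ℝ] HH) : ℝ := ∑ e : Fin 4, ⟪A (stdBasis e), B (stdBasis e)⟫_ℝ

/-- The complex multiplication by `i` on `HH`-valued linear maps: complex numbers act on `HH` by
quaternionic multiplication on the right. -/
def mulI (A : HH →ₗ[ℝ] HH) : HH →ₗ[ℝ] HH := LinearMap.mulRight ℝ (unit 0) ∘ₗ A

/-- The almost complex structures `I · A = -A ∘ I` (for `a = 0`), and likewise `J` and `K`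
(for `a = 1, 2`), where `I, J, K` act on `HH` by left multiplication by `i, j, k`. -/
def cplx (a : Fin 3) (A : HH →ₗ[ℝ] HH) : HH →ₗ[ℝ] HH := -(A ∘ₗ LinearMap.mulLeft ℝ (unit a))

/-- The involutions `R_I, R_J, R_K`, given by `R A = i (I · A)`, and so on. -/
def involution (a : Fin 3) (A : HH →ₗ[ℝ] HH) : HH →ₗ[ℝ] HH := mulI (cplx a A)

/-- The fibrewise moment maps `-(1/2) g(R A, A)`. -/
def fibreMoment (a : Fin 3) (A : HH →ₗ[ℝ] HH) : ℝ :=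
  -(1 / 2) * fibreInner (involution a A) A

/-! ### Euclidean triangulations of the torus `M = HH / Γ` -/

/-- The quotient torus. -/
abbrev Torus (Γ : Submodule ℤ HH) : Type := HH ⧸ Γ.toAddSubgroup

/-- The canonical projection `p : HH → M`. -/
def proj (Γ : Submodule ℤ HH) (x : HH) : Torus Γ := QuotientAddGroup.mk x

/-- The image in the torus of the convex hull of a finite set of points. -/
def shadow (Γ : Submodule ℤ HH) (s : Finset HH) : Set (Torus Γ) :=
  proj Γ '' convexHull ℝ (s : Set HH)

/-- `σ` is a Euclidean simplex of the torus, and `s` is the vertex set of a Euclidean simplex of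
`HH` which the projection maps bijectively onto `σ`. -/
structure IsLift (Γ : Submodule ℤ HH) (s : Finset HH) (σ : Set (Torus Γ)) : Prop where
  nonempty : s.Nonempty
  affineIndependent : AffineIndependent ℝ ((↑) : s → HH)
  injOn : Set.InjOn (proj Γ) (convexHull ℝ (s : Set HH))
  image_eq : shadow Γ s = σ

/-- `ρ` is a face of the Euclidean simplex `σ`. -/
def IsFace (Γ : Submodule ℤ HH) (ρ σ : Set (Torus Γ)) : Prop :=
  ∃ s t : Finset HH, IsLift Γ s σ ∧ t ⊆ s ∧ t.Nonempty ∧ shadow Γ t = ρ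

/-- A Euclidean triangulation of the torus: a (finite) simplicial decomposition all of whose cells
are Euclidean simplices. -/
structure Triangulation (Γ : Submodule ℤ HH) where
  /-- The closed cells, of all dimensions. -/
  cells : Set (Set (Torus Γ))
  finite : cells.Finite
  isSimplex : ∀ σ ∈ cells, ∃ s, IsLift Γ s σ
  face_mem : ∀ σ ∈ cells, ∀ ρ, IsFace Γ ρ σ → ρ ∈ cells
  inter_isFace : ∀ σ ∈ cells, ∀ τ ∈ cells, (σ ∩ τ).Nonempty →
    IsFace Γ (σ ∩ τ) σ ∧ IsFace Γ (σ ∩ τ) τ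
  covers : ⋃₀ cells = Set.univ

namespace Triangulation

variable {Γ : Submodule ℤ HH} (T : Triangulation Γ)

/-- The four-dimensional cells: those with five vertices. -/
def FourCell : Type := {σ : Set (Torus Γ) // σ ∈ T.cells ∧ ∃ s, IsLift Γ s σ ∧ s.card = 5}

instance : Finite T.FourCell :=
  (T.finite.subset (fun _ h => h.1 :
    {σ | σ ∈ T.cells ∧ ∃ s, IsLift Γ s σ ∧ s.card = 5} ⊆ T.cells)).to_subtype

instance : Fintype T.FourCell := Fintype.ofFinite _

/-- The vertices of a simplex of `HH` over a given four-cell. It is unique up to translation by an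
element of `Γ`. -/
def vertices (σ : T.FourCell) : Finset HH := σ.2.2.choose

/-- The volume of a four-cell for the flat metric of the torus. -/
def vol (σ : T.FourCell) : ℝ :=
  (MeasureTheory.volume (convexHull ℝ (T.vertices σ : Set HH))).toReal

theorem vol_pos (σ : T.FourCell) : 0 < T.vol σ := by
  obtain ⟨hl, hc⟩ := σ.2.2.choose_spec
  have hcpt : IsCompact (convexHull ℝ (T.vertices σ : Set HH)) :=
    (T.vertices σ).finite_toSet.isCompact_convexHull ℝ
  refine ENNReal.toReal_pos ?_ hcpt.measure_lt_top.ne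
  have hspan : affineSpan ℝ (T.vertices σ : Set HH) = ⊤ := by
    have h := (hl.affineIndependent.affineSpan_eq_top_iff_card_eq_finrank_add_one).2
      (by rw [Fintype.card_coe, hc, Quaternion.finrank_eq_four])
    simpa [vertices] using h
  exact (MeasureTheory.Measure.measure_pos_of_nonempty_interior _
    (interior_convexHull_nonempty_iff_affineSpan_eq_top.2 hspan)).ne'

/-! ### The space of locally constant `HH`-valued one-forms -/

/-- The space `𝓕` of locally constant `HH`-valued `1`-forms on the complement of the `3`-skeleton:
a constant `ℝ`-linear map `HH → HH` for (the interior of) each four-cell. -/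
def Forms : Type := T.FourCell → (HH →ₗ[ℝ] HH)

instance : AddCommGroup T.Forms := inferInstanceAs (AddCommGroup (T.FourCell → (HH →ₗ[ℝ] HH)))

instance : Module ℝ T.Forms := inferInstanceAs (Module ℝ (T.FourCell → (HH →ₗ[ℝ] HH)))

instance : FiniteDimensional ℝ T.Forms :=
  inferInstanceAs (FiniteDimensional ℝ (T.FourCell → (HH →ₗ[ℝ] HH)))

/-- The metric `𝓖(F₁, F₂) = ∑ g(F₁(σ), F₂(σ)) vol(σ)`, the sum over all four-cells. -/
def metric (F₁ F₂ : T.Forms) : ℝ := ∑ σ : T.FourCell, fibreInner (F₁ σ) (F₂ σ) * T.vol σ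

theorem eq_zero_of_stdBasis (A : HH →ₗ[ℝ] HH) (h : ∀ e, A (stdBasis e) = 0) : A = 0 := by
  ext1 x
  have hx : x = x.re • stdBasis 0 + x.imI • stdBasis 1 + x.imJ • stdBasis 2
      + x.imK • stdBasis 3 := by
    apply Quaternion.ext <;>
      simp only [Quaternion.re_add, Quaternion.imI_add, Quaternion.imJ_add, Quaternion.imK_add,
        Quaternion.re_smul, Quaternion.imI_smul, Quaternion.imJ_smul, Quaternion.imK_smul] <;>
      simp [stdBasis, unit, Quaternion.re_one, Quaternion.imI_one, Quaternion.imJ_one,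
        Quaternion.imK_one]
  rw [hx]
  simp [h]

/-- The metric `𝓖` is positive definite, so that `𝓕` becomes a Euclidean space. -/
@[reducible] def core : InnerProductSpace.Core ℝ T.Forms where
  inner := T.metric
  conj_inner_symm F₁ F₂ := by
    simp [metric, fibreInner, real_inner_comm]
  re_inner_nonneg F := by
    refine Finset.sum_nonneg fun σ _ => mul_nonneg ?_ (T.vol_pos σ).le
    exact Finset.sum_nonneg fun e _ => real_inner_self_nonneg
  add_left F₁ F₂ F₃ := by
    change ∑ σ : T.FourCell, fibreInner (F₁ σ + F₂ σ) (F₃ σ) * T.vol σ = _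
    simp [metric, fibreInner, inner_add_left, Finset.sum_add_distrib, add_mul]
  smul_left F₁ F₂ r := by
    change ∑ σ : T.FourCell, fibreInner (r • F₁ σ) (F₂ σ) * T.vol σ = _
    simp [metric, fibreInner, real_inner_smul_left, Finset.mul_sum, mul_assoc, Finset.sum_mul]
  definite F h := by
    have hn : ∀ σ ∈ Finset.univ, 0 ≤ fibreInner (F σ) (F σ) * T.vol σ := fun σ _ =>
      mul_nonneg (Finset.sum_nonneg fun e _ => real_inner_self_nonneg) (T.vol_pos σ).le
    have h0 := (Finset.sum_eq_zero_iff_of_nonneg hn).1 h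
    funext σ
    refine eq_zero_of_stdBasis _ fun e => ?_
    have h1 : fibreInner (F σ) (F σ) = 0 :=
      (mul_eq_zero.1 (h0 σ (Finset.mem_univ _))).resolve_right (T.vol_pos σ).ne'
    have h2 := (Finset.sum_eq_zero_iff_of_nonneg
      (fun e _ => real_inner_self_nonneg)).1 h1 e (Finset.mem_univ _)
    exact inner_self_eq_zero.1 h2

instance : NormedAddCommGroup T.Forms := T.core.toNormedAddCommGroup

instance : InnerProductSpace ℝ T.Forms := InnerProductSpace.ofCore T.core.toCore

instance : CompleteSpace T.Forms := FiniteDimensional.complete ℝ T.Forms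

/-! ### Whitney forms and cohomology -/

/-- The space `𝓕^c` of Whitney forms: the pullbacks of `F(σ)` and `F(τ)` to the common face `σ ∩ τ`
of two four-cells `σ`, `τ` agree. -/
def whitney : Submodule ℝ T.Forms where
  carrier := {F | ∀ σ τ : T.FourCell, ∀ t : Finset HH, IsLift Γ t (σ.1 ∩ τ.1) →
    ∀ v ∈ vectorSpan ℝ (t : Set HH), F σ v = F τ v}
  zero_mem' := fun _ _ _ _ _ _ => rfl
  add_mem' := fun {F G} hF hG σ τ t ht v hv => by
    change F σ v + G σ v = F τ v + G τ v
    rw [hF σ τ t ht v hv, hG σ τ t ht v hv]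
  smul_mem' := fun r F hF σ τ t ht v hv => by
    change r • F σ v = r • F τ v
    rw [hF σ τ t ht v hv]

/-- An `HH`-valued polyhedral function on the torus: it is continuous and its lift to `HH` is affine
on every simplex of `HH` that lies over a cell. -/
structure IsPolyhedral (u : Torus Γ → HH) : Prop where
  continuous : Continuous u
  affine : ∀ σ ∈ T.cells, ∀ s, IsLift Γ s σ →
    ∃ f : HH →ᵃ[ℝ] HH, ∀ x ∈ convexHull ℝ (s : Set HH), u (proj Γ x) = f x

/-- `F` is the differential of `u`: on each four-cell `σ`, the form `F(σ)` is the linear part of the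
affine map that `u` defines on the simplices of `HH` over `σ`. -/
def IsDifferential (u : Torus Γ → HH) (F : T.Forms) : Prop :=
  ∀ σ : T.FourCell, ∀ s, IsLift Γ s σ.1 →
    ∃ f : HH →ᵃ[ℝ] HH, f.linear = F σ ∧ ∀ x ∈ convexHull ℝ (s : Set HH), u (proj Γ x) = f x

/-- The space of differentials of `HH`-valued polyhedral functions. -/
def exact : Submodule ℝ T.Forms where
  carrier := {F | ∃ u, T.IsPolyhedral u ∧ T.IsDifferential u F}
  zero_mem' := ⟨fun _ => 0, ⟨continuous_const, fun _ _ _ _ => ⟨0, fun _ _ => rfl⟩⟩,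
    fun _ _ _ => ⟨0, rfl, fun _ _ => rfl⟩⟩
  add_mem' := by
    rintro F G ⟨u, hu, hF⟩ ⟨w, hw, hG⟩
    refine ⟨fun x => u x + w x, ⟨hu.continuous.add hw.continuous, fun σ hσ s hs => ?_⟩,
      fun σ s hs => ?_⟩
    · obtain ⟨f, hf⟩ := hu.affine σ hσ s hs
      obtain ⟨k, hk⟩ := hw.affine σ hσ s hs
      exact ⟨f + k, fun x hx => by simp [hf x hx, hk x hx]⟩
    · obtain ⟨f, hf', hf⟩ := hF σ s hs
      obtain ⟨k, hk', hk⟩ := hG σ s hs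
      refine ⟨f + k, ?_, fun x hx => by simp [hf x hx, hk x hx]⟩
      change f.linear + k.linear = F σ + G σ
      rw [hf', hk']
  smul_mem' := by
    rintro r F ⟨u, hu, hF⟩
    refine ⟨fun x => r • u x, ⟨hu.continuous.const_smul r, fun σ hσ s hs => ?_⟩,
      fun σ s hs => ?_⟩
    · obtain ⟨f, hf⟩ := hu.affine σ hσ s hs
      exact ⟨r • f, fun x hx => by simp [hf x hx]⟩
    · obtain ⟨f, hf', hf⟩ := hF σ s hs
      refine ⟨r • f, ?_, fun x hx => by simp [hf x hx]⟩
      change r • f.linear = r • F σ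
      rw [hf']

/-- The cohomology group `H^1(M, HH)`: Whitney forms modulo differentials of polyhedral functions. -/
abbrev H1 : Type := T.whitney ⧸ T.exact.comap T.whitney.subtype

/-- The cohomology class of a Whitney form. -/
def cohomClass : T.whitney →ₗ[ℝ] T.H1 := (T.exact.comap T.whitney.subtype).mkQ

/-- The space `𝓕^c_α` of Whitney forms whose cohomology class is a real multiple of `α`. -/
def closedForms (α : T.H1) : Submodule ℝ T.Forms :=
  ((Submodule.span ℝ {α}).comap T.cohomClass).map T.whitney.subtype

/-! ### The hyperkähler moment map and the modified moment map flow -/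

/-- The hyperkähler moment map `(μ_I, μ_J, μ_K) : 𝓕 → 𝔱³`, where `𝔱` is the space of locally
constant real functions. -/
def moment (F : T.Forms) : Fin 3 → T.FourCell → ℝ := fun a σ => fibreMoment a (F σ)

/-- The functional `φ = ½ ‖μ‖²`, with `‖μ‖² = ∑ ∫_M μ_•²`. -/
def energy (F : T.Forms) : ℝ :=
  1 / 2 * ∑ a : Fin 3, ∑ σ : T.FourCell, T.moment F a σ ^ 2 * T.vol σ

/-- The restriction of the moment map to `𝓕^c_α`. -/
def momentOn (α : T.H1) (F : T.closedForms α) : Fin 3 → T.FourCell → ℝ := T.moment F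

/-- `𝓕^c_α ∩ μ⁻¹(0)`. -/
def zeroLocus (α : T.H1) : Set (T.closedForms α) := {F | T.momentOn α F = 0}

/-- A regular point: the moment map on `𝓕^c_α` has constant rank on a neighbourhood of the point. -/
def IsRegular (α : T.H1) (F : T.closedForms α) : Prop :=
  ∃ r : ℕ, ∀ᶠ G in 𝓝 F,
    Module.finrank ℝ (LinearMap.range (fderiv ℝ (T.momentOn α) G).toLinearMap) = r

/-- The right-hand side `-Π_α ∇φ(F)` of the modified moment map flow. Here `∇φ` is the gradient for
the metric `𝓖`, and `Π_α` is the `𝓖`-orthogonal projection of `𝓕` onto `𝓕^c_α`. -/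
def flowField (α : T.H1) (F : T.closedForms α) : T.closedForms α :=
  -(T.closedForms α).orthogonalProjectionOnto (gradient T.energy (F : T.Forms))

/-- A solution, for times `t ∈ [0, ∞)`, of the modified moment map flow `∂F/∂t = -Π_α ∇φ(F)`. -/
def IsFlowLine (α : T.H1) (γ : ℝ → T.closedForms α) : Prop :=
  ∀ t : ℝ, 0 ≤ t → HasDerivWithinAt γ (T.flowField α (γ t)) (Set.Ici 0) t

end Triangulation

end PolyTorus

end

/-!
The moment map `μ` is homogeneous of degree two, so by Euler's identity `μ(x) = dμₓ(x/2)` lies in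
the range of `dμₓ`. Near a regular point the rank of `dμ` is constant, hence its nonzero singular
values are bounded below and `‖∇φ‖ = ‖dμ* μ‖ ≥ c‖μ‖`. Along the flow `x' = -∇φ(x)` this makes `‖μ‖`
decay like `exp(-λt)`, while the speed is at most `B‖μ‖`. A flow line starting at `x₀` therefore has
length at most `(B/λ)‖μ(x₀)‖`, which is bounded by a multiple of the distance from `x₀` to the zero
locus: this traps it near `F` and yields its limit with the exponential estimate.
-/

noncomputable section

open Set Metric Filter
open scoped NNReal Manifold InnerProduct

theorem forall_mem_of_continuousOn_of_mapsTo_Ico {X : Type*} [TopologicalSpace X] {γ : ℝ → X}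
    {U : Set X} {a : ℝ} (hγ : ContinuousOn γ (Ici a)) (hU : IsOpen U)
    (hstep : ∀ τ, a ≤ τ → MapsTo γ (Ico a τ) U → γ τ ∈ U) {t : ℝ} (ht : a ≤ t) : γ t ∈ U := by
  by_contra hout
  have hcompact : IsCompact (Icc a t ∩ γ ⁻¹' Uᶜ) :=
    isCompact_Icc.of_isClosed_subset
      ((hγ.mono Icc_subset_Ici_self).preimage_isClosed_of_isClosed isClosed_Icc hU.isClosed_compl)
      inter_subset_left
  obtain ⟨τ, ⟨hτ, hτU⟩, hτmin⟩ := hcompact.exists_isLeast ⟨t, ⟨ht, le_rfl⟩, hout⟩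
  refine hτU (hstep τ hτ.1 fun s hs => ?_)
  by_contra hsU
  exact hs.2.not_ge (hτmin ⟨⟨hs.1, hs.2.le.trans hτ.2⟩, hsU⟩)

theorem tendsto_const_mul_exp_neg (A : ℝ) {lam : ℝ} (hlam : 0 < lam) :
    Tendsto (fun t : ℝ => A * Real.exp (-(lam * t))) atTop (𝓝 0) := by
  simpa using (Real.tendsto_exp_neg_atTop_nhds_zero.comp
    (tendsto_id.const_mul_atTop hlam)).const_mul A

theorem exists_tendsto_of_dist_le_exp {X : Type*} [PseudoMetricSpace X] [CompleteSpace X]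
    {γ : ℝ → X} {A lam : ℝ} (hlam : 0 < lam)
    (hle : ∀ a b, 0 ≤ a → a ≤ b → dist (γ b) (γ a) ≤ A * Real.exp (-(lam * a))) :
    ∃ x, Tendsto γ atTop (𝓝 x) ∧ ∀ t, 0 ≤ t → dist (γ t) x ≤ A * Real.exp (-(lam * t)) := by
  have hcauchy : CauchySeq γ := by
    refine Metric.cauchySeq_iff'.2 fun ε hε => ?_
    obtain ⟨a, ha, hlt⟩ := ((eventually_ge_atTop 0).and
      ((tendsto_const_mul_exp_neg A hlam).eventually_lt_const hε)).exists
    exact ⟨a, fun b hab => (hle a b ha hab).trans_lt hlt⟩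
  obtain ⟨x, hx⟩ := cauchySeq_tendsto_of_complete hcauchy
  refine ⟨x, hx, fun t ht => ?_⟩
  rw [dist_comm]
  exact le_of_tendsto (hx.dist tendsto_const_nhds)
    ((eventually_ge_atTop t).mono fun s hs => hle t s ht hs)

theorem norm_le_exp_of_inner_deriv_le {N : Type*} [NormedAddCommGroup N] [InnerProductSpace ℝ N]
    {y y' : ℝ → N} {K a b : ℝ} (hy : ContinuousOn y (Icc a b))
    (hy' : ∀ t ∈ Ico a b, HasDerivWithinAt y (y' t) (Ici t) t)
    (hle : ∀ t ∈ Ico a b, ⟪y t, y' t⟫_ℝ ≤ K * ‖y t‖ ^ 2) {t : ℝ} (ht : t ∈ Icc a b) :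
    ‖y t‖ ≤ ‖y a‖ * Real.exp (K * (t - a)) := by
  have hsq : ‖y t‖ ^ 2 ≤ ‖y a‖ ^ 2 * Real.exp (2 * K * (t - a)) := by
    rw [← gronwallBound_ε0]
    refine le_gronwallBound_of_liminf_deriv_right_le (hy.norm.pow 2)
      (fun s hs r hr => (hy' s hs).norm_sq.liminf_right_slope_le hr) le_rfl (fun s hs => ?_) t ht
    simp only [Pi.pow_apply]
    linarith [hle s hs]
  refine le_of_sq_le_sq ?_ (by positivity)
  rwa [mul_pow, ← Real.exp_nat_mul, Nat.cast_ofNat, ← mul_assoc]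

theorem eventually_norm_le_mul_infDist {α F : Type*} [PseudoMetricSpace α] [NormedAddCommGroup F]
    {f : α → F} {K : ℝ≥0} {s : Set α} {z : α} (hf : LipschitzOnWith K f s) (hs : s ∈ 𝓝 z)
    (hz : f z = 0) : ∀ᶠ x in 𝓝 z, ‖f x‖ ≤ K * infDist x (f ⁻¹' {0}) := by
  obtain ⟨r, hr, hrs⟩ := nhds_basis_closedBall.mem_iff.1 hs
  filter_upwards [closedBall_mem_nhds z (half_pos hr)] with x hx
  have hxs : x ∈ s := hrs (closedBall_subset_closedBall (half_le_self hr.le) hx)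
  have hle : ∀ y ∈ s, f y = 0 → ‖f x‖ ≤ K * dist x y := fun y hy hy0 => by
    simpa [dist_eq_norm, hy0] using hf.dist_le_mul x hxs y hy
  have hdist : ∀ y ∈ f ⁻¹' {0}, ‖f x‖ ≤ K * dist x y := by
    intro y hy
    rcases le_total (dist x y) (r / 2) with hxy | hxy
    · refine hle y (hrs ?_) hy
      rw [mem_closedBall] at hx ⊢
      linarith [dist_triangle_left y z x]
    · -- `z` is a nearer zero than `y`
      calc ‖f x‖ ≤ K * dist x z := hle z (mem_of_mem_nhds hs) hz
        _ ≤ K * dist x y := by gcongr; exact (mem_closedBall.1 hx).trans hxy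
  rw [infDist_eq_iInf, Real.mul_iInf_of_nonneg K.coe_nonneg]
  have : Nonempty (f ⁻¹' {0}) := ⟨⟨z, hz⟩⟩
  exact le_ciInf fun y => hdist y y.2

section Damping

variable {E : Type*} [NormedAddCommGroup E] [NormedSpace ℝ E]

theorem norm_sub_le_of_norm_deriv_le_exp {γ γ' : ℝ → E} {A lam a b : ℝ} (hlam : lam ≠ 0)
    (hγ : ContinuousOn γ (Icc a b)) (hγ' : ∀ t ∈ Ico a b, HasDerivWithinAt γ (γ' t) (Ici t) t)
    (hle : ∀ t ∈ Ico a b, ‖γ' t‖ ≤ A * Real.exp (-(lam * t))) {t : ℝ} (ht : t ∈ Icc a b) :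
    ‖γ t - γ a‖ ≤ A / lam * (Real.exp (-(lam * a)) - Real.exp (-(lam * t))) := by
  refine image_norm_le_of_norm_deriv_right_le_deriv_boundary
    (B := fun s => A / lam * (Real.exp (-(lam * a)) - Real.exp (-(lam * s))))
    (hγ.sub continuousOn_const) (fun s hs => (hγ' s hs).sub_const (γ a)) (by simp) (fun s => ?_)
    hle ht
  have hexp : HasDerivAt (fun s => Real.exp (-(lam * s))) (Real.exp (-(lam * s)) * -(lam * 1)) s :=
    ((hasDerivAt_id s).const_mul lam).neg.exp
  refine ((hexp.const_sub (Real.exp (-(lam * a)))).const_mul (A / lam)).congr_deriv ?_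
  field_simp

theorem exists_isIntegralCurve_of_hasCompactSupport [CompleteSpace E] {v : E → E}
    (hv : ContDiff ℝ 1 v) (hsupp : HasCompactSupport v) (x₀ : E) :
    ∃ γ : ℝ → E, γ 0 = x₀ ∧ IsIntegralCurve γ fun _ => v := by
  obtain ⟨K, hK⟩ := hv.lipschitzWith_of_hasCompactSupport hsupp one_ne_zero
  obtain ⟨L, hL⟩ := hsupp.exists_bound_of_continuous hv.continuous
  have hlocal : ∀ x, ∃ γ : ℝ → E, γ 0 = x ∧ IsIntegralCurveOn γ (fun _ => v) (Ioo (-1) 1) := by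
    intro x
    have hpl : IsPicardLindelof (fun _ => v) (tmin := -1) (tmax := 1) ⟨0, by simp⟩ x
        L.toNNReal 0 L.toNNReal K :=
      .of_time_independent (fun y _ => (hL y).trans (Real.le_coe_toNNReal L))
        hK.lipschitzOnWith (by simp)
    obtain ⟨γ, h0, hγ⟩ := hpl.exists_eq_forall_mem_Icc_hasDerivWithinAt₀
    exact ⟨γ, h0, fun t ht => (hγ t (Ioo_subset_Icc_self ht)).mono Ioo_subset_Icc_self⟩
  obtain ⟨γ, h0, hγ⟩ := exists_isMIntegralCurve_of_isMIntegralCurveOn (I := 𝓘(ℝ, E))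
    (contMDiff_vectorSpace_iff_contDiff.2 hv) one_pos (fun x => by
      obtain ⟨γ, h0, hγ⟩ := hlocal x
      exact ⟨γ, h0, fun t ht => (hγ t ht).hasFDerivWithinAt.hasMFDerivWithinAt⟩) x₀
  exact ⟨γ, h0, fun t => hasDerivAt_iff_hasFDerivAt.2 (hasMFDerivAt_iff_hasFDerivAt.1 (hγ t))⟩

variable {N : Type*} [NormedAddCommGroup N] [InnerProductSpace ℝ N]

/-- The vector field `v` damps the map `m` on `s`: wherever a curve in `s` follows `v`, the norm of
`m` decays at the rate `lam`, and the speed of the curve is at most `B * ‖m‖`. -/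
structure IsDampedOn (v : E → E) (m : E → N) (lam B : ℝ) (s : Set E) : Prop where
  differentiableAt : ∀ x ∈ s, DifferentiableAt ℝ m x
  inner_fderiv_le : ∀ x ∈ s, ⟪m x, fderiv ℝ m x (v x)⟫_ℝ ≤ -lam * ‖m x‖ ^ 2
  norm_le : ∀ x ∈ s, ‖v x‖ ≤ B * ‖m x‖

namespace IsDampedOn

variable {v w : E → E} {m : E → N} {lam B : ℝ} {s : Set E} {γ : ℝ → E}

theorem mono {s' : Set E} (h : IsDampedOn v m lam B s) (hs : s' ⊆ s) : IsDampedOn v m lam B s' :=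
  ⟨fun x hx => h.1 x (hs hx), fun x hx => h.2 x (hs hx), fun x hx => h.3 x (hs hx)⟩

theorem congr (h : IsDampedOn v m lam B s) (hw : EqOn w v s) : IsDampedOn w m lam B s :=
  ⟨h.1, fun x hx => hw hx ▸ h.2 x hx, fun x hx => hw hx ▸ h.3 x hx⟩

theorem norm_comp_le (h : IsDampedOn v m lam B s) (hγ : IsIntegralCurveOn γ (fun _ => v) (Ici 0))
    {t : ℝ} (ht : 0 ≤ t) (hmaps : MapsTo γ (Icc 0 t) s) :
    ‖m (γ t)‖ ≤ ‖m (γ 0)‖ * Real.exp (-(lam * t)) := by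
  have hderiv : ∀ τ ∈ Icc 0 t,
      HasDerivWithinAt (m ∘ γ) (fderiv ℝ m (γ τ) (v (γ τ))) (Ici 0) τ := fun τ hτ =>
    (h.differentiableAt _ (hmaps hτ)).hasFDerivAt.comp_hasDerivWithinAt τ (hγ τ hτ.1)
  have hgronwall := norm_le_exp_of_inner_deriv_le (y := m ∘ γ) (K := -lam)
    (fun τ hτ => (hderiv τ hτ).continuousWithinAt.mono Icc_subset_Ici_self)
    (fun τ hτ => (hderiv τ (Ico_subset_Icc_self hτ)).mono (Ici_subset_Ici.2 hτ.1))
    (fun τ hτ => h.inner_fderiv_le _ (hmaps (Ico_subset_Icc_self hτ))) ⟨ht, le_rfl⟩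
  simpa using hgronwall

theorem norm_sub_le (h : IsDampedOn v m lam B s) (hlam : lam ≠ 0) (hB : 0 ≤ B)
    (hγ : IsIntegralCurveOn γ (fun _ => v) (Ici 0)) {a b : ℝ} (ha : 0 ≤ a) (hab : a ≤ b)
    (hmaps : MapsTo γ (Ico 0 b) s) :
    ‖γ b - γ a‖ ≤
      B / lam * ‖m (γ 0)‖ * (Real.exp (-(lam * a)) - Real.exp (-(lam * b))) := by
  have hspeed : ∀ t ∈ Ico a b, ‖v (γ t)‖ ≤ B * ‖m (γ 0)‖ * Real.exp (-(lam * t)) := by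
    intro t ht
    have ht0 : 0 ≤ t := ha.trans ht.1
    calc ‖v (γ t)‖ ≤ B * ‖m (γ t)‖ := h.norm_le _ (hmaps ⟨ht0, ht.2⟩)
      _ ≤ B * (‖m (γ 0)‖ * Real.exp (-(lam * t))) := by
        gcongr
        exact h.norm_comp_le hγ ht0 (hmaps.mono_left (Icc_subset_Ico_right ht.2))
      _ = B * ‖m (γ 0)‖ * Real.exp (-(lam * t)) := by ring
  have hlength := norm_sub_le_of_norm_deriv_le_exp hlam
    (hγ.continuousOn.mono (Icc_subset_Ici_self.trans (Ici_subset_Ici.2 ha)))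
    (fun t ht => (hγ t (ha.trans ht.1)).mono (Ici_subset_Ici.2 (ha.trans ht.1))) hspeed
    (right_mem_Icc.2 hab)
  rwa [div_mul_eq_mul_div]

theorem mem_ball {F : E} {ε : ℝ} (h : IsDampedOn v m lam B (ball F ε)) (hlam : 0 < lam)
    (hB : 0 ≤ B) (hγ : IsIntegralCurveOn γ (fun _ => v) (Ici 0))
    (h0 : ‖γ 0 - F‖ + B / lam * ‖m (γ 0)‖ < ε) {t : ℝ} (ht : 0 ≤ t) : γ t ∈ ball F ε := by
  refine forall_mem_of_continuousOn_of_mapsTo_Ico hγ.continuousOn isOpen_ball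
    (fun τ hτ hmaps => ?_) ht
  have hlength : ‖γ τ - γ 0‖ ≤ B / lam * ‖m (γ 0)‖ := by
    refine (h.norm_sub_le hlam.ne' hB hγ le_rfl hτ hmaps).trans
      (mul_le_of_le_one_right (by positivity) ?_)
    simpa using (Real.exp_pos (-(lam * τ))).le
  rw [mem_ball_iff_norm]
  linarith [norm_sub_le_norm_sub_add_norm_sub (γ τ) (γ 0) F]

theorem exists_limit [CompleteSpace E] (h : IsDampedOn v m lam B s) (hs : IsClosed s)
    (hlam : 0 < lam) (hB : 0 ≤ B) (hγ : IsIntegralCurveOn γ (fun _ => v) (Ici 0))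
    (hmaps : MapsTo γ (Ici 0) s) :
    ∃ x ∈ s, m x = 0 ∧
      ∀ t, 0 ≤ t → ‖γ t - x‖ ≤ B / lam * ‖m (γ 0)‖ * Real.exp (-(lam * t)) := by
  obtain ⟨x, hx, hxle⟩ := exists_tendsto_of_dist_le_exp (γ := γ)
    (A := B / lam * ‖m (γ 0)‖) hlam fun a b ha hab => by
      rw [dist_eq_norm]
      refine (h.norm_sub_le hlam.ne' hB hγ ha hab (hmaps.mono_left Ico_subset_Ici_self)).trans ?_
      gcongr
      exact sub_le_self _ (Real.exp_pos _).le
  have hxs : x ∈ s := hs.mem_of_tendsto hx ((eventually_ge_atTop 0).mono fun t ht => hmaps ht)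
  refine ⟨x, hxs, ?_, fun t ht => dist_eq_norm (γ t) x ▸ hxle t ht⟩
  have hmzero : Tendsto (m ∘ γ) atTop (𝓝 0) := by
    refine squeeze_zero_norm' ?_ (tendsto_const_mul_exp_neg ‖m (γ 0)‖ hlam)
    filter_upwards [eventually_ge_atTop 0] with t ht
    exact h.norm_comp_le hγ ht (hmaps.mono_left Icc_subset_Ici_self)
  exact tendsto_nhds_unique ((h.differentiableAt x hxs).continuousAt.tendsto.comp hx) hmzero

end IsDampedOn

/-- The flow of `v` is stable near `F` and converges to `Z` exponentially fast, with constants that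
do not depend on the neighbourhood `U` and a distance to the limit controlled by the initial
distance to `Z`. Integral curves are taken on `[0, ∞)`, with a one-sided derivative at `0`. -/
def IsExponentiallyStable (v : E → E) (Z : Set E) (F : E) : Prop :=
  ∃ C : ℝ, 0 < C ∧ ∃ lam : ℝ, 0 < lam ∧ ∀ U ∈ 𝓝 F, ∃ W ∈ 𝓝 F, ∀ F₀ ∈ W,
    (∃ γ : ℝ → E, IsIntegralCurveOn γ (fun _ => v) (Ici 0) ∧ γ 0 = F₀) ∧
    ∀ γ : ℝ → E, IsIntegralCurveOn γ (fun _ => v) (Ici 0) → γ 0 = F₀ →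
      (∀ t, 0 ≤ t → γ t ∈ U) ∧
      ∃ x ∈ U, x ∈ Z ∧ ∀ t, 0 ≤ t → ‖γ t - x‖ ≤ C * Real.exp (-(lam * t)) * infDist F₀ Z

theorem IsDampedOn.exists_isIntegralCurveOn [FiniteDimensional ℝ E] {v : E → E} {m : E → N}
    {lam B : ℝ} {F F₀ : E} {ε : ℝ}
    (h : IsDampedOn v m lam B (ball F ε)) (hlam : 0 < lam) (hB : 0 ≤ B) (hv : ContDiff ℝ 1 v)
    (hF₀ : ‖F₀ - F‖ + B / lam * ‖m F₀‖ < ε) :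
    ∃ γ : ℝ → E, IsIntegralCurveOn γ (fun _ => v) (Ici 0) ∧ γ 0 = F₀ := by
  have := FiniteDimensional.complete ℝ E
  have hε : 0 < ε := hF₀.trans_le' (by positivity)
  -- A curve trapped in the ball does not see a cut-off of `v` outside it, and the cut-off flow is
  -- complete.
  let χ : ContDiffBump F := ⟨ε, ε + 1, hε, lt_add_one ε⟩
  have hcut : EqOn (fun x => χ x • v x) v (ball F ε) := fun x hx => by
    simp [χ.one_of_mem_closedBall (ball_subset_closedBall hx)]
  obtain ⟨γ, h0, hγ⟩ := exists_isIntegralCurve_of_hasCompactSupport (v := fun x => χ x • v x)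
    (χ.contDiff.smul hv) χ.hasCompactSupport.smul_right F₀
  refine ⟨γ, fun t ht => ?_, h0⟩
  have hmem : γ t ∈ ball F ε :=
    (h.congr hcut).mem_ball hlam hB (hγ.isIntegralCurveOn _) (h0 ▸ hF₀) ht
  exact (hγ.isIntegralCurveOn _ t ht).congr_deriv (hcut hmem)

theorem IsDampedOn.isExponentiallyStable [FiniteDimensional ℝ E] {v : E → E} {m : E → N}
    {lam B : ℝ} {s : Set E} {K : ℝ≥0} {F : E} (h : IsDampedOn v m lam B s) (hlam : 0 < lam)
    (hB : 0 < B) (hs : s ∈ 𝓝 F) (hv : ContDiff ℝ 1 v) (hm : LipschitzOnWith K m s)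
    (hF : m F = 0) : IsExponentiallyStable v (m ⁻¹' {0}) F := by
  have := FiniteDimensional.complete ℝ E
  refine ⟨B / lam * (K + 1), by positivity, lam, hlam, fun U hU => ?_⟩
  obtain ⟨ε, hε, hεsub⟩ := nhds_basis_closedBall.mem_iff.1 (inter_mem hU hs)
  have hclosed : IsDampedOn v m lam B (closedBall F ε) := h.mono fun x hx => (hεsub hx).2
  have hopen : IsDampedOn v m lam B (ball F ε) := hclosed.mono ball_subset_closedBall
  have hsmall : ∀ᶠ x in 𝓝 F, ‖x - F‖ + B / lam * ‖m x‖ < ε := by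
    have hcont : ContinuousAt (fun x => ‖x - F‖ + B / lam * ‖m x‖) F := by
      have := (h.differentiableAt F (mem_of_mem_nhds hs)).continuousAt
      fun_prop
    exact hcont.eventually_lt_const (by simpa [hF] using hε)
  refine ⟨_, hsmall.and (eventually_norm_le_mul_infDist hm hs hF), ?_⟩
  rintro F₀ ⟨hF₀, hdist⟩
  refine ⟨hopen.exists_isIntegralCurveOn hlam hB.le hv hF₀, ?_⟩
  rintro γ hγ rfl
  have hmem : MapsTo γ (Ici 0) (closedBall F ε) := fun t ht =>
    ball_subset_closedBall (hopen.mem_ball hlam hB.le hγ hF₀ ht)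
  obtain ⟨x, hx, hx0, hxle⟩ := hclosed.exists_limit isClosed_closedBall hlam hB.le hγ hmem
  refine ⟨fun t ht => (hεsub (hmem ht)).1, x, (hεsub hx).1, hx0, fun t ht => ?_⟩
  calc ‖γ t - x‖ ≤ B / lam * ‖m (γ 0)‖ * Real.exp (-(lam * t)) := hxle t ht
    _ ≤ B / lam * ((K + 1) * infDist (γ 0) (m ⁻¹' {0})) * Real.exp (-(lam * t)) := by
      gcongr
      exact hdist.trans (by gcongr; exacts [infDist_nonneg, le_add_of_nonneg_right zero_le_one])
    _ = B / lam * (K + 1) * Real.exp (-(lam * t)) * infDist (γ 0) (m ⁻¹' {0}) := by ring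

end Damping

section ConstantRank

variable {X E N : Type*} [TopologicalSpace X] [NormedAddCommGroup E] [NormedSpace ℝ E]
  [FiniteDimensional ℝ E] [NormedAddCommGroup N] [NormedSpace ℝ N]

theorem exists_eventually_antilipschitzWith {A : X → E →L[ℝ] N} {x₀ : X} (hA : ContinuousAt A x₀)
    (hinj : Function.Injective (A x₀)) :
    ∃ K : ℝ≥0, 0 < K ∧ ∀ᶠ x in 𝓝 x₀, AntilipschitzWith K (A x) := by
  obtain ⟨K, hK, hanti : AntilipschitzWith K (A x₀)⟩ :=
    (A x₀).toLinearMap.injective_iff_antilipschitz.1 hinj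
  have hclose : ∀ᶠ x in 𝓝 x₀, ‖A x - A x₀‖₊ < K⁻¹ / 2 := by
    have hzero : ‖A x₀ - A x₀‖₊ < K⁻¹ / 2 := by simpa using hK
    exact (hA.sub continuousAt_const).nnnorm.eventually_lt_const hzero
  refine ⟨(K⁻¹ / 2)⁻¹, by positivity, hclose.mono fun x hx => ?_⟩
  have hlt : ‖A x - A x₀‖₊ < K⁻¹ := hx.trans (half_lt_self (inv_pos.2 hK))
  have hgap : K⁻¹ / 2 ≤ K⁻¹ - ‖A x - A x₀‖₊ := by
    rw [le_tsub_iff_right hlt.le]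
    calc K⁻¹ / 2 + ‖A x - A x₀‖₊ ≤ K⁻¹ / 2 + K⁻¹ / 2 := by gcongr
      _ = K⁻¹ := add_halves _
  refine fun a b => (hanti.add_sub_lipschitzWith (A x - A x₀).lipschitz hlt a b).trans ?_
  gcongr
  exact le_rfl

theorem exists_eventually_forall_mem_range_exists_norm_le {A : X → E →L[ℝ] N} {x₀ : X}
    (hA : ContinuousAt A x₀) {r : ℕ}
    (hr : ∀ᶠ x in 𝓝 x₀, Module.finrank ℝ (LinearMap.range (A x).toLinearMap) = r) :
    ∃ k : ℝ, 0 < k ∧ ∀ᶠ x in 𝓝 x₀, ∀ y ∈ LinearMap.range (A x).toLinearMap,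
      ∃ w, A x w = y ∧ ‖w‖ ≤ k * ‖y‖ := by
  -- A complement `S` of `ker (A x₀)` is mapped injectively by every nearby `A x`, and onto the
  -- range because the rank is constant.
  obtain ⟨S, hS⟩ := Submodule.exists_isCompl (LinearMap.ker (A x₀).toLinearMap)
  have hdim : Module.finrank ℝ S = r := by
    have hcompl := Submodule.finrank_add_eq_of_isCompl hS
    have hrankNullity := (A x₀).toLinearMap.finrank_range_add_finrank_ker
    have := hr.self_of_nhds
    omega
  have hinj : Function.Injective ((A x₀).comp S.subtypeL) := by
    refine (injective_iff_map_eq_zero _).2 fun w hw => Subtype.ext ?_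
    exact Submodule.disjoint_def.1 hS.disjoint w hw w.2
  obtain ⟨K, hK, hanti⟩ := exists_eventually_antilipschitzWith
    (A := fun x => (A x).comp S.subtypeL) (hA.clm_comp continuousAt_const) hinj
  refine ⟨K, hK, ?_⟩
  filter_upwards [hanti, hr] with x hx hrx y hy
  have hrange : LinearMap.range ((A x).comp S.subtypeL).toLinearMap =
      LinearMap.range (A x).toLinearMap :=
    Submodule.eq_of_le_of_finrank_eq (LinearMap.range_comp_le_range _ _)
      (by rw [LinearMap.finrank_range_of_inj hx.injective, hdim, hrx])
  obtain ⟨w, rfl⟩ := hrange ▸ hy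
  exact ⟨w, rfl, by simpa using hx.le_mul_norm_sub w 0⟩

end ConstantRank

section Adjoint

variable {X E N : Type*} [TopologicalSpace X] [NormedAddCommGroup E] [InnerProductSpace ℝ E]
  [FiniteDimensional ℝ E] [CompleteSpace E] [NormedAddCommGroup N] [InnerProductSpace ℝ N]
  [CompleteSpace N]

theorem exists_eventually_norm_le_mul_norm_adjoint {A : X → E →L[ℝ] N} {x₀ : X}
    (hA : ContinuousAt A x₀) {r : ℕ}
    (hr : ∀ᶠ x in 𝓝 x₀, Module.finrank ℝ (LinearMap.range (A x).toLinearMap) = r) :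
    ∃ k : ℝ, 0 < k ∧ ∀ᶠ x in 𝓝 x₀, ∀ y ∈ LinearMap.range (A x).toLinearMap,
      ‖y‖ ≤ k * ‖((A x)†) y‖ := by
  obtain ⟨k, hk, hpre⟩ := exists_eventually_forall_mem_range_exists_norm_le hA hr
  refine ⟨k, hk, hpre.mono fun x hx y hy => ?_⟩
  obtain ⟨w, hw, hle⟩ := hx y hy
  rcases (norm_nonneg y).eq_or_lt with hy0 | hy0
  · rw [← hy0]
    positivity
  refine le_of_mul_le_mul_right ?_ hy0
  calc ‖y‖ * ‖y‖ = ⟪((A x)†) y, w⟫_ℝ := by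
        rw [ContinuousLinearMap.adjoint_inner_left, hw, real_inner_self_eq_norm_mul_norm]
    _ ≤ ‖((A x)†) y‖ * ‖w‖ := real_inner_le_norm _ _
    _ ≤ ‖((A x)†) y‖ * (k * ‖y‖) := by gcongr
    _ = k * ‖((A x)†) y‖ * ‖y‖ := by ring

end Adjoint

section HomogeneousMaps

variable {E N : Type*} [NormedAddCommGroup E] [NormedSpace ℝ E] [NormedAddCommGroup N]
  [NormedSpace ℝ N]

theorem fderiv_apply_self_of_homogeneous {m : E → N} {n : ℕ}
    (hhom : ∀ (t : ℝ) x, m (t • x) = t ^ n • m x) {x : E} (hm : DifferentiableAt ℝ m x) :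
    fderiv ℝ m x x = (n : ℝ) • m x := by
  have hray : HasDerivAt (fun t : ℝ => t • x) x 1 := by
    simpa using (hasDerivAt_id (1 : ℝ)).smul_const x
  have hchain : HasDerivAt (fun t : ℝ => m (t • x)) (fderiv ℝ m x x) 1 :=
    HasFDerivAt.comp_hasDerivAt 1 (by simpa using hm.hasFDerivAt) hray
  have hpow : HasDerivAt (fun t : ℝ => m (t • x)) ((n : ℝ) • m x) 1 := by
    simp only [hhom]
    simpa using (hasDerivAt_pow n (1 : ℝ)).smul_const (m x)
  exact hchain.unique hpow

theorem mem_range_fderiv_of_homogeneous {m : E → N} {n : ℕ} (hn : n ≠ 0)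
    (hhom : ∀ (t : ℝ) x, m (t • x) = t ^ n • m x) {x : E} (hm : DifferentiableAt ℝ m x) :
    m x ∈ LinearMap.range (fderiv ℝ m x).toLinearMap := by
  refine ⟨(n : ℝ)⁻¹ • x, ?_⟩
  rw [ContinuousLinearMap.coe_coe, map_smul, fderiv_apply_self_of_homogeneous hhom hm,
    inv_smul_smul₀ (Nat.cast_ne_zero.2 hn)]

end HomogeneousMaps

section Gradient

variable {E N : Type*} [NormedAddCommGroup E] [InnerProductSpace ℝ E] [CompleteSpace E]
  [NormedAddCommGroup N] [InnerProductSpace ℝ N] [CompleteSpace N]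

theorem contDiff_gradient {φ : E → ℝ} {n : WithTop ℕ∞} (hφ : ContDiff ℝ (n + 1) φ) :
    ContDiff ℝ n (gradient φ) :=
  (InnerProductSpace.toDual ℝ E).symm.toContinuousLinearEquiv.contDiff.comp
    (hφ.fderiv_right le_rfl)

theorem gradient_comp_coe (S : Submodule ℝ E) [CompleteSpace S] {φ : E → ℝ} {x : S}
    (hφ : DifferentiableAt ℝ φ x) :
    gradient (fun y : S => φ y) x = S.orthogonalProjectionOnto (gradient φ x) := by
  have hchain : HasFDerivAt (fun y : S => φ y) _ x :=
    hφ.hasGradientAt.hasFDerivAt.comp x S.subtypeL.hasFDerivAt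
  refine (hasGradientAt_iff_hasFDerivAt.2 (hchain.congr_fderiv ?_)).gradient
  ext y
  exact (Submodule.inner_orthogonalProjectionOnto_eq_of_mem_right y (gradient φ x)).symm

theorem gradient_half_norm_sq {m : E → N} {x : E} (hm : DifferentiableAt ℝ m x) :
    gradient (fun y => 1 / 2 * ‖m y‖ ^ 2) x = ((fderiv ℝ m x)†) (m x) := by
  refine (hasGradientAt_iff_hasFDerivAt.2
    ((hm.hasFDerivAt.norm_sq.const_mul (1 / 2)).congr_fderiv ?_)).gradient
  ext w
  simp [ContinuousLinearMap.adjoint_inner_left]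

end Gradient

section GradientFlow

variable {E N : Type*} [NormedAddCommGroup E] [InnerProductSpace ℝ E] [CompleteSpace E]
  [NormedAddCommGroup N] [InnerProductSpace ℝ N] [CompleteSpace N]

theorem exists_isDampedOn_neg_adjoint_fderiv {m : E → N} {F : E} {k : ℝ}
    (hm : ContDiff ℝ 1 m) (hk : 0 < k)
    (hlow : ∀ᶠ x in 𝓝 F, ‖m x‖ ≤ k * ‖((fderiv ℝ m x)†) (m x)‖) :
    ∃ lam : ℝ, 0 < lam ∧ ∃ B : ℝ, 0 < B ∧
      ∀ᶠ s in (𝓝 F).smallSets, IsDampedOn (fun x => -((fderiv ℝ m x)†) (m x)) m lam B s := by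
  have hbound : ∀ᶠ x in 𝓝 F, ‖fderiv ℝ m x‖ < ‖fderiv ℝ m F‖ + 1 :=
    (hm.continuous_fderiv one_ne_zero).norm.continuousAt.eventually_lt_const (lt_add_one _)
  refine ⟨(k ^ 2)⁻¹, by positivity, ‖fderiv ℝ m F‖ + 1, by positivity, ?_⟩
  refine (hlow.and hbound).smallSets.mono fun s hs => ⟨fun x _ =>
    (hm.differentiable one_ne_zero).differentiableAt, fun x hx => ?_, fun x hx => ?_⟩
  · have hsq : ‖m x‖ ^ 2 ≤ k ^ 2 * ‖((fderiv ℝ m x)†) (m x)‖ ^ 2 := by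
      rw [← mul_pow]
      gcongr
      exact (hs x hx).1
    rw [map_neg, inner_neg_right, ← ContinuousLinearMap.adjoint_inner_left,
      real_inner_self_eq_norm_sq, neg_mul, neg_le_neg_iff, inv_mul_le_iff₀ (by positivity)]
    exact hsq
  · calc ‖-((fderiv ℝ m x)†) (m x)‖ ≤ ‖(fderiv ℝ m x)†‖ * ‖m x‖ := by
          rw [norm_neg]
          exact ContinuousLinearMap.le_opNorm _ _
      _ ≤ (‖fderiv ℝ m F‖ + 1) * ‖m x‖ := by
          gcongr
          rw [LinearIsometryEquiv.norm_map]
          exact (hs x hx).2.le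

theorem isExponentiallyStable_neg_gradient_half_norm_sq [FiniteDimensional ℝ E] {m : E → N}
    {n r : ℕ} {F : E} (hm : ContDiff ℝ 2 m) (hn : n ≠ 0)
    (hhom : ∀ (t : ℝ) x, m (t • x) = t ^ n • m x)
    (hr : ∀ᶠ x in 𝓝 F, Module.finrank ℝ (LinearMap.range (fderiv ℝ m x).toLinearMap) = r)
    (hF : m F = 0) :
    IsExponentiallyStable (fun x => -gradient (fun y => 1 / 2 * ‖m y‖ ^ 2) x) (m ⁻¹' {0}) F := by
  have hm1 : ContDiff ℝ 1 m := hm.of_le one_le_two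
  have hdiff : Differentiable ℝ m := hm.differentiable two_ne_zero
  obtain ⟨k, hk, hlow⟩ := exists_eventually_norm_le_mul_norm_adjoint
    (hm1.continuous_fderiv one_ne_zero).continuousAt hr
  obtain ⟨lam, hlam, B, hB, hdamped⟩ := exists_isDampedOn_neg_adjoint_fderiv hm1 hk
    (hlow.mono fun x hx => hx _ (mem_range_fderiv_of_homogeneous hn hhom hdiff.differentiableAt))
  obtain ⟨K, s, hs, hLip⟩ := (hm1.contDiffAt (x := F)).exists_lipschitzOnWith
  obtain ⟨u, hu, hus⟩ := eventually_smallSets.1 hdamped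
  have hgrad : ∀ x, -gradient (fun y => 1 / 2 * ‖m y‖ ^ 2) x = -((fderiv ℝ m x)†) (m x) := by
    intro x
    rw [gradient_half_norm_sq hdiff.differentiableAt]
  exact ((hus (s ∩ u) inter_subset_right).congr fun x _ => hgrad x).isExponentiallyStable hlam hB
    (inter_mem hs hu) (contDiff_gradient (contDiff_const.mul (hm.norm_sq ℝ))).neg
    (hLip.mono inter_subset_left) hF

end GradientFlow

namespace PolyTorus.Triangulation

variable {Γ : Submodule ℤ HH} (T : Triangulation Γ)

/-- Evaluation of a form on a four-cell at a vector. -/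
def evalCLM (σ : T.FourCell) (v : HH) : T.Forms →L[ℝ] HH :=
  LinearMap.toContinuousLinearMap
    { toFun := fun F => F σ v
      map_add' := fun _ _ => rfl
      map_smul' := fun _ _ => rfl }

theorem moment_apply (F : T.Forms) (a : Fin 3) (σ : T.FourCell) :
    T.moment F a σ = -(1 / 2) * ∑ e : Fin 4,
      ⟪-(T.evalCLM σ (unit a * stdBasis e) F) * unit 0, T.evalCLM σ (stdBasis e) F⟫_ℝ :=
  rfl

theorem contDiff_moment {n : WithTop ℕ∞} : ContDiff ℝ n T.moment := by
  refine contDiff_pi.2 fun a => contDiff_pi.2 fun σ => ?_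
  simp only [moment_apply]
  exact contDiff_const.mul (ContDiff.sum fun e _ => ContDiff.inner ℝ
    ((T.evalCLM σ _).contDiff.neg.mul contDiff_const) (T.evalCLM σ _).contDiff)

theorem moment_smul (t : ℝ) (F : T.Forms) : T.moment (t • F) = t ^ 2 • T.moment F := by
  funext a σ
  simp only [Pi.smul_apply, smul_eq_mul, moment_apply, map_smul, Finset.mul_sum]
  refine Finset.sum_congr rfl fun e _ => ?_
  rw [← smul_neg, smul_mul_assoc, real_inner_smul_left, real_inner_smul_right]
  ring

/-- The space `𝔱³` of triples of locally constant real functions, as a Euclidean space. -/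
abbrev EuclideanTriples : Type := EuclideanSpace ℝ (Fin 3 × T.FourCell)

/-- The identification of `𝔱³` with a Euclidean space; the weights `√vol` turn the norm
`∑ ∫_M f_•²` of `𝔱³` into the standard one. -/
def weighting : (Fin 3 → T.FourCell → ℝ) →L[ℝ] T.EuclideanTriples :=
  LinearMap.toContinuousLinearMap
    { toFun := fun f => WithLp.toLp 2 fun p => √(T.vol p.2) * f p.1 p.2
      map_add' := fun f g => by ext p; exact mul_add _ _ _
      map_smul' := fun c f => by ext p; exact mul_left_comm _ _ _ }

theorem weighting_apply (f : Fin 3 → T.FourCell → ℝ) (p : Fin 3 × T.FourCell) :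
    T.weighting f p = √(T.vol p.2) * f p.1 p.2 :=
  rfl

theorem weighting_injective : Function.Injective T.weighting := by
  intro f g h
  funext a σ
  have hentry : √(T.vol σ) * f a σ = √(T.vol σ) * g a σ := congrArg (fun x => x (a, σ)) h
  exact mul_left_cancel₀ (Real.sqrt_pos.2 (T.vol_pos σ)).ne' hentry

theorem energy_eq_half_norm_weighting_sq (F : T.Forms) :
    T.energy F = 1 / 2 * ‖T.weighting (T.moment F)‖ ^ 2 := by
  rw [EuclideanSpace.real_norm_sq_eq, Fintype.sum_prod_type, energy]
  simp only [weighting_apply, mul_pow, Real.sq_sqrt (T.vol_pos _).le, mul_comm]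

theorem contDiff_energy {n : WithTop ℕ∞} : ContDiff ℝ n T.energy := by
  have henergy : T.energy = fun F => 1 / 2 * ‖T.weighting (T.moment F)‖ ^ 2 :=
    funext T.energy_eq_half_norm_weighting_sq
  rw [henergy]
  exact contDiff_const.mul ((T.weighting.contDiff.comp T.contDiff_moment).norm_sq ℝ)

/-- The moment map on `𝓕^c_α`, with values in the Euclidean model of `𝔱³`. -/
def weightedMomentOn (α : T.H1) (F : T.closedForms α) : T.EuclideanTriples :=
  T.weighting (T.momentOn α F)

variable (α : T.H1)

theorem contDiff_momentOn {n : WithTop ℕ∞} : ContDiff ℝ n (T.momentOn α) :=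
  T.contDiff_moment.comp (T.closedForms α).subtypeL.contDiff

theorem contDiff_weightedMomentOn {n : WithTop ℕ∞} : ContDiff ℝ n (T.weightedMomentOn α) :=
  T.weighting.contDiff.comp (T.contDiff_momentOn α)

theorem weightedMomentOn_smul (t : ℝ) (F : T.closedForms α) :
    T.weightedMomentOn α (t • F) = t ^ 2 • T.weightedMomentOn α F := by
  rw [weightedMomentOn, weightedMomentOn, ← map_smul]
  exact congrArg T.weighting (T.moment_smul t F)

theorem weightedMomentOn_preimage_zero : T.weightedMomentOn α ⁻¹' {0} = T.zeroLocus α :=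
  Set.ext fun _ => map_eq_zero_iff T.weighting T.weighting_injective

theorem finrank_range_fderiv_weightedMomentOn (G : T.closedForms α) :
    Module.finrank ℝ (LinearMap.range (fderiv ℝ (T.weightedMomentOn α) G).toLinearMap) =
      Module.finrank ℝ (LinearMap.range (fderiv ℝ (T.momentOn α) G).toLinearMap) := by
  have hfderiv : fderiv ℝ (T.weightedMomentOn α) G =
      T.weighting.comp (fderiv ℝ (T.momentOn α) G) :=
    (T.weighting.hasFDerivAt.comp G ((T.contDiff_momentOn α).differentiable
      one_ne_zero).differentiableAt.hasFDerivAt).fderiv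
  rw [hfderiv, ContinuousLinearMap.toLinearMap_comp, LinearMap.range_comp]
  exact (Submodule.equivMapOfInjective _ T.weighting_injective _).finrank_eq.symm

theorem flowField_eq_neg_gradient :
    T.flowField α = fun F => -gradient (fun G => 1 / 2 * ‖T.weightedMomentOn α G‖ ^ 2) F := by
  funext F
  have henergy : (fun G => 1 / 2 * ‖T.weightedMomentOn α G‖ ^ 2) =
      fun G : T.closedForms α => T.energy G :=
    funext fun G => (T.energy_eq_half_norm_weighting_sq G).symm
  rw [henergy, gradient_comp_coe _ (T.contDiff_energy.differentiable one_ne_zero).differentiableAt]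
  rfl

end PolyTorus.Triangulation

end

theorem mainTheorem10 (Γ : Submodule ℤ PolyTorus.HH) [DiscreteTopology Γ] [IsZLattice ℝ Γ]
    (T : PolyTorus.Triangulation Γ) (α : T.H1) (F : T.closedForms α)
    (hzero : F ∈ T.zeroLocus α) (hreg : T.IsRegular α F) :
    ∃ C : ℝ, 0 < C ∧ ∃ lam : ℝ, 0 < lam ∧ ∀ U ∈ 𝓝 F, ∃ W ∈ 𝓝 F, ∀ F₀ ∈ W,
      (∃ γ : ℝ → T.closedForms α, T.IsFlowLine α γ ∧ γ 0 = F₀) ∧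
      ∀ γ : ℝ → T.closedForms α, T.IsFlowLine α γ → γ 0 = F₀ →
        (∀ t : ℝ, 0 ≤ t → γ t ∈ U) ∧
        ∃ Finf ∈ U, Finf ∈ T.zeroLocus α ∧
          ∀ t : ℝ, 0 ≤ t → ‖γ t - Finf‖ ≤
            C * Real.exp (-(lam * t)) * Metric.infDist F₀ (T.zeroLocus α) := by
  obtain ⟨r, hr⟩ := hreg
  have hrank : ∀ᶠ G in 𝓝 F, Module.finrank ℝ
      (LinearMap.range (fderiv ℝ (T.weightedMomentOn α) G).toLinearMap) = r :=
    hr.mono fun G hG => (T.finrank_range_fderiv_weightedMomentOn α G).trans hG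
  have hstable : IsExponentiallyStable (T.flowField α) (T.zeroLocus α) F := by
    rw [← T.weightedMomentOn_preimage_zero] at hzero ⊢
    rw [T.flowField_eq_neg_gradient]
    exact isExponentiallyStable_neg_gradient_half_norm_sq (T.contDiff_weightedMomentOn α)
      two_ne_zero (T.weightedMomentOn_smul α) hrank hzero
  exact hstable
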